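/- Let $\mathcal D$ be a set (the domain). For a finite set $\Lambda$ of attributes, an attributed relation with scheme $\Lambda$ is a set $P\subseteq\mathcal D^{\Lambda}$; its arity is $|\Lambda|$. A relation $R\subseteq\mathcal D^{n}$ is a subternaric bond when $$R(x_1,\dots,x_n)\iff\exists\,t_1\cdots\exists\,t_k\in\mathcal D\ \big[P_1\land\dots\land P_N\big]$$ for some $k,N\ge 0$, where each factor $P_i$ is an attributed relation of arity $1$, $2$ or $3$ whose scheme is a set of variables among $x_1,\dots,x_n,t_1,\dots,t_k$, such that every free variable $x_j$ occurs in exactly one of the schemes and every bound variable $t_l$ occurs in exactly two of them. The ternarity $\mathrm{ter}(R)\in\{0,1,2,\dots,\infty\}$ is the minimal number of factors of arity $3$ in such representations of $R$, and $\infty$ if there are none. **Theorem.** Let $n\ge 4$ and $m\ge 0$ be integers. For a finite domain $\mathcal D$ consider the share $$s_{n,m}(\mathcal D)=\frac{\big|\{R\subseteq\mathcal D^n:\ \mathrm{ter}(R)\le m\}\big|}{\big|\{R: R\subseteq\mathcal D^n\}\big|}.$$ 1. If $|\mathcal D|\ge 2$ and $|\mathcal D|>\binom{\lfloor (3m+n)/2\rfloor}{n-1}$,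 then $s_{n,m}(\mathcal D)<1$. 2. $s_{n,m}(\mathcal D)\to 0$ as $|\mathcal D|\to\infty$, with $n$ and $m$ fixed. 3. In particular, there are $n$-ary relations of arbitrarily high ternarity: there are a finite domain $\mathcal D$ and a relation $R\subseteq\mathcal D^n$ with $\mathrm{ter}(R)>m$. -/

import Mathlib

/-- An attributed relation on the domain `D` with relation scheme `Λ` (a finite set of attributes):
a set of functions from `Λ` to `D`. Its arity is `Λ.card`. -/
abbrev AttrRel (D : Type*) {A : Type*} (Λ : Finset A) : Type _ := Set (Λ → D)

/-- The natural join of attributed relations whose schemes lie in the attribute set `A`, as a set of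
tuples on all of `A`: the tuples whose subtuple on every scheme belongs to the respective factor.
(It is used for schemes that cover `A`.) -/
def naturalJoin {D A ι : Type*} (Λ : ι → Finset A) (F : ∀ i, AttrRel D (Λ i)) : Set (A → D) :=
  {a | ∀ i, (fun p : Λ i => a p.1) ∈ F i}

/-- A bond with free attributes `S` on the domain `D`: finitely many attributed relations (the
factors) of positive arity, whose attributes are the elements of `S` (free) together with
finitely many parameters (bound). No three schemes share an attribute, every attribute belongs
to some scheme, and the attributes shared by two schemes are exactly the parameters. -/
structure Bond (D S : Type*) where
  /-- the number of parameters -/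
  params : ℕ
  /-- the number of factors -/
  size : ℕ
  /-- the relation schemes of the factors -/
  scheme : Fin size → Finset (S ⊕ Fin params)
  /-- the factors -/
  factor : ∀ i, AttrRel D (scheme i)
  scheme_nonempty : ∀ i, (scheme i).Nonempty
  free_once : ∀ s : S, {i | Sum.inl s ∈ scheme i}.ncard = 1
  bound_twice : ∀ t : Fin params, {i | Sum.inr t ∈ scheme i}.ncard = 2

namespace Bond

/-- The relation represented by a bond: the projection to the free attributes of the natural join
of the factors, i.e. all parameters are existentially quantified. -/
def toRel {D S : Type*} (B : Bond D S) : Set (S → D) :=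
  (fun a : S ⊕ Fin B.params → D => fun s => a (Sum.inl s)) '' naturalJoin B.scheme B.factor

/-- A bond is subternaric when all of its factors have arity at most `3`. -/
def IsSubternaric {D S : Type*} (B : Bond D S) : Prop :=
  ∀ i, (B.scheme i).card ≤ 3

/-- The number of ternary factors of a bond. -/
def numTernaries {D S : Type*} (B : Bond D S) : ℕ :=
  (Finset.univ.filter fun i => (B.scheme i).card = 3).card

end Bond

/-- The ternarity of a relation: the minimal number of ternary factors in its representations as a
subternaric bond, and `⊤` when there are none. -/
noncomputable def ternarity {D S : Type*} (R : Set (S → D)) : ℕ∞ :=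
  sInf {t : ℕ∞ | ∃ B : Bond D S, B.toRel = R ∧ B.IsSubternaric ∧ t = (B.numTernaries : ℕ∞)}

/-- The share of the `n`-ary relations of ternarity at most `m` among all `n`-ary relations on a
finite domain `D`. -/
noncomputable def ternarityShare (D : Type*) (n m : ℕ) : ℝ :=
  ({R : Set (Fin n → D) | ternarity R ≤ (m : ℕ∞)}.ncard : ℝ) / (Nat.card (Set (Fin n → D)) : ℝ)

/-! Relations of ternarity at most `m` are counted by means of a normal form. A parameter attached
to a factor of arity at most 2 can be eliminated by merging its two factors, without raising any
arity or the number of ternary factors (`IsNet.contract`). When this stops, every remaining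
parameter joins two ternary factors. If all free attributes also lie in ternary factors, counting
incidences gives n + 2p ≤ 3m for the number p of parameters left. Otherwise a factor of arity at
most 2 shares nothing with the rest, and the relation is a product.

In both cases the relation is a projected join of factors of arity at most n - 1 on n + p
attributes, with p bounded. It is thus determined by one (n-1)-ary relation for each (n-1)-set of
attributes, which leaves at most 2^(binom(n+p, n-1)·d^(n-1)) relations out of 2^(d^n) when the
domain has d elements. -/

/-- A set of tuples is supported on the attributes `K` when membership depends only on the
subtuple on `K`. -/
def SupportedOn {D A : Type*} (G : Set (A → D)) (K : Finset A) : Prop :=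
  ∀ ⦃a b : A → D⦄, (∀ x ∈ K, a x = b x) → a ∈ G → b ∈ G

/-- The projection to the free attributes of the intersection of a family of sets of tuples. -/
def projJoin {D S T ι : Type*} (G : ι → Set (S ⊕ T → D)) : Set (S → D) :=
  {s | ∃ a : S ⊕ T → D, (∀ i, a ∈ G i) ∧ ∀ x, a (Sum.inl x) = s x}

/-- A bond-like family of schemes and factors representing `R`, with the factors given as sets of
tuples on all attributes; empty schemes and parameters in fewer than two schemes are allowed. -/
structure IsNet {D S T ι : Type*} [Fintype ι] (m : ℕ) (R : Set (S → D))
    (L : ι → Finset (S ⊕ T)) (G : ι → Set (S ⊕ T → D)) : Prop where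
  supported : ∀ i, SupportedOn (G i) (L i)
  free : ∀ s, ∃! i, Sum.inl s ∈ L i
  bound : ∀ t i j k, Sum.inr t ∈ L i → Sum.inr t ∈ L j → Sum.inr t ∈ L k →
    i = j ∨ i = k ∨ j = k
  card_le : ∀ i, (L i).card ≤ 3
  ternaries_le : (Finset.univ.filter fun i => (L i).card = 3).card ≤ m
  rel_eq : projJoin G = R

/-- The parameters that occur in some scheme. -/
def activeParams {S T ι : Type*} [Fintype T] [DecidableEq S] [DecidableEq T] [Fintype ι]
    (L : ι → Finset (S ⊕ T)) : Finset T :=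
  Finset.univ.filter fun t => ∃ i, Sum.inr t ∈ L i

/-! ### Eliminating parameters by contraction -/

section Contraction

variable {D S T ι : Type*} [DecidableEq S] [DecidableEq T] [DecidableEq ι] {m : ℕ} {R : Set (S → D)} {L : ι → Finset (S ⊕ T)}
  {G : ι → Set (S ⊕ T → D)}

/-- The schemes after contracting the parameter `t` shared by the schemes `i` and `j`. -/
def contractScheme (L : ι → Finset (S ⊕ T)) (t : T) (i j : ι) : ι → Finset (S ⊕ T) :=
  fun l => if l = j then (L i ∪ L j).erase (Sum.inr t) else if l = i then ∅ else L l

/-- The factors after contracting the parameter `t` shared by the factors `i` and `j`. -/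
def contractFactor (G : ι → Set (S ⊕ T → D)) (t : T) (i j : ι) : ι → Set (S ⊕ T → D) :=
  fun l => if l = j then
      {a | ∃ v, Function.update a (Sum.inr t) v ∈ G i ∧ Function.update a (Sum.inr t) v ∈ G j}
    else if l = i then Set.univ else G l

theorem mem_contractScheme {t : T} {i j l : ι} {x : S ⊕ T} :
    x ∈ contractScheme L t i j l ↔
      (l = j ∧ x ≠ Sum.inr t ∧ (x ∈ L i ∨ x ∈ L j)) ∨ (l ≠ j ∧ l ≠ i ∧ x ∈ L l) := by
  unfold contractScheme
  split_ifs with h1 h2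
  · simp [h1]
  · subst h2
    simp [h1]
  · simp [h1, h2]

/-- Joining two distinct schemes along `t` loses `t` from both, so the new arity is at most |L i| +
|L j| - 2; this is where arity at most 2 matters. The case `i = j` merely projects `t` away. -/
theorem card_contractScheme_le {t : T} {i j : ι} (hi : Sum.inr t ∈ L i) (hj : Sum.inr t ∈ L j)
    (hij : i = j ∨ (L i).card ≤ 2) (l : ι) :
    (contractScheme L t i j l).card ≤ (L l).card := by
  unfold contractScheme
  split_ifs with h1 h2
  · subst h1
    rw [Finset.card_erase_of_mem (Finset.mem_union_left _ hi)]
    rcases hij with rfl | hij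
    · simp
    · have h := Finset.card_union_add_card_inter (L i) (L l)
      have : 0 < (L i ∩ L l).card := Finset.card_pos.2 ⟨_, Finset.mem_inter.2 ⟨hi, hj⟩⟩
      omega
  · simp
  · exact le_rfl

variable [Fintype ι]

theorem IsNet.contract (h : IsNet m R L G) {t : T} {i j : ι} (hi : Sum.inr t ∈ L i)
    (hj : Sum.inr t ∈ L j) (hij : i = j ∨ (L i).card ≤ 2)
    (hall : ∀ l, Sum.inr t ∈ L l → l = i ∨ l = j) :
    IsNet m R (contractScheme L t i j) (contractFactor G t i j) where
  supported l a b hab ha := by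
    have hL := fun x => mem_contractScheme (L := L) (t := t) (i := i) (j := j) (l := l) (x := x)
    unfold contractFactor at ha ⊢
    split_ifs at ha ⊢ with h1 h2
    · obtain ⟨v, hvi, hvj⟩ := ha
      have key : ∀ x, x ∈ L i ∨ x ∈ L j →
          Function.update a (Sum.inr t) v x = Function.update b (Sum.inr t) v x := by
        intro x hx
        by_cases hxt : x = Sum.inr t
        · subst hxt; simp
        · simpa [hxt] using hab x ((hL x).2 (Or.inl ⟨h1, hxt, hx⟩))
      exact ⟨v, h.supported i (fun x hx => key x (Or.inl hx)) hvi,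
        h.supported j (fun x hx => key x (Or.inr hx)) hvj⟩
    · trivial
    · exact h.supported l (fun x hx => hab x ((hL x).2 (Or.inr ⟨h1, h2, hx⟩))) ha
  free s := by
    obtain ⟨l, hl, hu⟩ := h.free s
    simp only [mem_contractScheme]
    by_cases hlij : l = i ∨ l = j
    · refine ⟨j, Or.inl ⟨rfl, by simp, ?_⟩, ?_⟩
      · rcases hlij with rfl | rfl
        · exact Or.inl hl
        · exact Or.inr hl
      · rintro k (hk | ⟨hk1, hk2, hk⟩)
        · exact hk.1
        · have := hu k hk
          grind
    · refine ⟨l, Or.inr ⟨by tauto, by tauto, hl⟩, ?_⟩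
      rintro k (⟨-, -, hk | hk⟩ | ⟨-, -, hk⟩)
      · exact absurd (Or.inl (hu i hk).symm) hlij
      · exact absurd (Or.inr (hu j hk).symm) hlij
      · exact hu k hk
  bound u a b c := by
    simp only [mem_contractScheme]
    have := h.bound u
    grind
  card_le l := (card_contractScheme_le hi hj hij l).trans (h.card_le l)
  ternaries_le := by
    -- Arities start at most 3 and never grow, so a scheme that is ternary now was ternary before.
    refine (Finset.card_le_card ?_).trans h.ternaries_le
    intro l
    simp only [Finset.mem_filter, Finset.mem_univ, true_and]
    have h1 := card_contractScheme_le hi hj hij l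
    have h2 := h.card_le l
    omega
  rel_eq := by
    rw [← h.rel_eq]
    ext s
    constructor
    · rintro ⟨a, ha, has⟩
      have hj' := ha j
      simp only [contractFactor, if_true] at hj'
      obtain ⟨v, hvi, hvj⟩ := hj'
      refine ⟨Function.update a (Sum.inr t) v, fun l => ?_, fun x => by simpa using has x⟩
      by_cases hlj : l = j
      · exact hlj ▸ hvj
      by_cases hli : l = i
      · exact hli ▸ hvi
      have hl := ha l
      simp only [contractFactor, if_neg hlj, if_neg hli] at hl
      refine h.supported l (fun x hx => ?_) hl
      have hxt : x ≠ Sum.inr t := by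
        rintro rfl
        exact (hall l hx).elim hli hlj
      simp [hxt]
    · rintro ⟨a, ha, has⟩
      refine ⟨a, fun l => ?_, has⟩
      unfold contractFactor
      split_ifs
      · exact ⟨a (Sum.inr t), by simpa using ha i, by simpa using ha j⟩
      · trivial
      · exact ha l

theorem card_activeParams_contractScheme_lt [Fintype T] {t : T} {i j : ι} (hi : Sum.inr t ∈ L i)
    (hall : ∀ l, Sum.inr t ∈ L l → l = i ∨ l = j) :
    (activeParams (contractScheme L t i j)).card < (activeParams L).card := by
  refine Finset.card_lt_card ⟨fun u => ?_, fun hs => ?_⟩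
  · simp only [activeParams, Finset.mem_filter, Finset.mem_univ, true_and, mem_contractScheme]
    grind
  · have := @hs t (by simpa [activeParams] using ⟨i, hi⟩)
    simp only [activeParams, Finset.mem_filter, Finset.mem_univ, true_and,
      mem_contractScheme] at this
    grind

/-- Every parameter in use is shared by two schemes, all of which have arity `3`. -/
def SharesTernaries (L : ι → Finset (S ⊕ T)) : Prop :=
  ∀ t i, Sum.inr t ∈ L i → (L i).card = 3 ∧ ∃ j, j ≠ i ∧ Sum.inr t ∈ L j

/-- Each violation of `SharesTernaries` permits a contraction, which lowers the number of parameters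
in use; the type `T` itself stays fixed. -/
theorem IsNet.exists_reduced [Fintype T] (h : IsNet m R L G) :
    ∃ (L' : ι → Finset (S ⊕ T)) (G' : ι → Set (S ⊕ T → D)), IsNet m R L' G' ∧ SharesTernaries L' := by
  induction hN : (activeParams L).card using Nat.strong_induction_on generalizing L G with
  | _ N ih =>
    by_cases hr : SharesTernaries L
    · exact ⟨L, G, h, hr⟩
    obtain ⟨t, i, j, hi, hj, hij, hall⟩ : ∃ t i j, Sum.inr t ∈ L i ∧ Sum.inr t ∈ L j ∧
        (i = j ∨ (L i).card ≤ 2) ∧ ∀ l, Sum.inr t ∈ L l → l = i ∨ l = j := by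
      simp only [SharesTernaries, not_forall] at hr
      obtain ⟨t, i, hi, hr⟩ := hr
      by_cases hex : ∃ j, j ≠ i ∧ Sum.inr t ∈ L j
      · obtain ⟨j, hji, hj⟩ := hex
        refine ⟨t, i, j, hi, hj, Or.inr ?_, fun l hl => ?_⟩
        · have h1 := h.card_le i
          have h2 : (L i).card ≠ 3 := fun h3 => hr ⟨h3, j, hji, hj⟩
          omega
        · have := h.bound t i j l hi hj hl
          grind
      · exact ⟨t, i, i, hi, hi, Or.inl rfl, fun l hl => by grind⟩
    exact ih _ (hN ▸ card_activeParams_contractScheme_lt hi hall)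
      (h.contract hi hj hij hall) rfl

/-! ### The two kinds of reduced net -/

variable [Fintype S]

/-- Counting incidences in a reduced net whose free attributes all lie in ternary schemes. -/
theorem IsNet.card_add_two_mul_le [Fintype T] (h : IsNet m R L G) (hr : SharesTernaries L)
    (hfree : ∀ s i, Sum.inl s ∈ L i → (L i).card = 3) :
    Fintype.card S + 2 * (activeParams L).card ≤ 3 * m := by
  set E := Finset.univ.filter fun i => (L i).card = 3 with hE
  have h1 : ∑ i ∈ E, (L i).card = 3 * E.card := by
    rw [Finset.sum_const_nat fun i hi => (Finset.mem_filter.1 hi).2, mul_comm]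
  have h2 : ∑ i ∈ E, (L i).card = ∑ x : S ⊕ T, (E.filter fun i => x ∈ L i).card := by
    simp only [Finset.card_eq_sum_ones (E.filter _), Finset.sum_filter]
    rw [Finset.sum_comm]
    simp
  -- Each free attribute contributes at least one incidence, each parameter in use at least two.
  rw [Fintype.sum_sum_type] at h2
  have h3 : Fintype.card S ≤ ∑ s : S, (E.filter fun i => Sum.inl s ∈ L i).card := by
    rw [← Finset.card_univ, Finset.card_eq_sum_ones]
    refine Finset.sum_le_sum fun s _ => Finset.card_pos.2 ?_
    obtain ⟨i, hi, -⟩ := h.free s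
    exact ⟨i, by simp [hE, hi, hfree s i hi]⟩
  have h4 : 2 * (activeParams L).card ≤ ∑ t : T, (E.filter fun i => Sum.inr t ∈ L i).card := by
    rw [mul_comm, ← smul_eq_mul]
    refine (Finset.card_nsmul_le_sum _ _ 2 fun t ht => ?_).trans
      (Finset.sum_le_sum_of_subset (Finset.subset_univ _))
    obtain ⟨i, hi⟩ := (Finset.mem_filter.1 ht).2
    obtain ⟨hc, j, hji, hj⟩ := hr t i hi
    exact Finset.one_lt_card.2 ⟨i, by simp [hE, hi, hc], j, by simp [hE, hj, (hr t j hj).1],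
      hji.symm⟩
  have h5 := h.ternaries_le
  rw [← hE] at h5
  omega

/-- If a free attribute of a reduced net lies in a scheme of arity at most `2`, then the relation
is a product of a relation of arity `1` or `2` and another relation. -/
theorem IsNet.eq_inter (h : IsNet m R L G) (hr : SharesTernaries L) {s : S} {i : ι}
    (hs : Sum.inl s ∈ L i) (hi : (L i).card ≠ 3) :
    ∃ (I : Finset S) (P Q : Set (S → D)), s ∈ I ∧ I.card ≤ 2 ∧ SupportedOn P I ∧
      SupportedOn Q Iᶜ ∧ R = P ∩ Q := by
  -- Reducedness bars parameters from this scheme, so factor `i` shares no attribute with the others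
  -- and splits off.
  have hno : ∀ t, Sum.inr t ∉ L i := fun t ht => hi (hr t i ht).1
  refine ⟨Finset.univ.filter fun x => Sum.inl x ∈ L i,
    {r | ∃ a ∈ G i, ∀ x, a (Sum.inl x) = r x},
    {r | ∃ a : S ⊕ T → D, (∀ l, l ≠ i → a ∈ G l) ∧ ∀ x, a (Sum.inl x) = r x},
    by simp [hs], ?_, ?_, ?_, ?_⟩
  · have h1 : ((Finset.univ.filter fun x => Sum.inl x ∈ L i).map
        (Function.Embedding.inl : S ↪ S ⊕ T)).card ≤ (L i).card := by
      refine Finset.card_le_card fun x hx => ?_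
      simp only [Finset.mem_map, Finset.mem_filter, Finset.mem_univ, true_and] at hx
      obtain ⟨y, hy, rfl⟩ := hx
      exact hy
    rw [Finset.card_map] at h1
    have := h.card_le i
    omega
  · rintro r r' hrr ⟨a, ha, har⟩
    refine ⟨Sum.elim r' (a ∘ Sum.inr), h.supported i ?_ ha, fun x => rfl⟩
    rintro (x | t) hx
    · simpa [har] using hrr x (by simpa using hx)
    · rfl
  · rintro r r' hrr ⟨a, ha, har⟩
    refine ⟨Sum.elim r' (a ∘ Sum.inr), fun l hl => h.supported l ?_ (ha l hl), fun x => rfl⟩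
    rintro (x | t) hx
    · have hxi : Sum.inl x ∉ L i := fun hxi => hl ((h.free x).unique hx hxi)
      simpa [har] using hrr x (by simpa using hxi)
    · rfl
  · rw [← h.rel_eq]
    ext r
    constructor
    · rintro ⟨a, ha, har⟩
      exact ⟨⟨a, ha i, har⟩, ⟨a, fun l _ => ha l, har⟩⟩
    · rintro ⟨⟨a, ha, har⟩, ⟨b, hb, hbr⟩⟩
      refine ⟨b, fun l => ?_, hbr⟩
      by_cases hl : l = i
      · subst hl
        refine h.supported l ?_ ha
        rintro (x | t) hx
        · rw [har, hbr]
        · exact absurd hx (hno t)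
      · exact hb l hl

end Contraction

/-! ### Normal form of relations of bounded ternarity -/

/-- A subternaric bond is a net. -/
theorem Bond.isNet {D S : Type*} (B : Bond D S) {m : ℕ}
    (hB : B.IsSubternaric) (hm : B.numTernaries ≤ m) :
    IsNet m B.toRel B.scheme (fun i => {a | (fun p : B.scheme i => a p.1) ∈ B.factor i}) where
  supported i a b hab ha := by
    have : (fun p : B.scheme i => a p.1) = fun p : B.scheme i => b p.1 :=
      funext fun p => hab p.1 p.2
    rw [Set.mem_ofPred_eq] at ha ⊢
    rwa [← this]
  free s := by
    obtain ⟨i, hi⟩ := Set.ncard_eq_one.1 (B.free_once s)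
    exact ⟨i, (Set.ext_iff.1 hi i).2 rfl, fun j hj => (Set.ext_iff.1 hi j).1 hj⟩
  bound t i j k hi hj hk := by
    obtain ⟨x, y, -, hxy⟩ := Set.ncard_eq_two.1 (B.bound_twice t)
    have := Set.ext_iff.1 hxy
    simp only [Set.mem_ofPred_eq, Set.mem_insert_iff, Set.mem_singleton_iff] at this
    grind
  card_le := hB
  ternaries_le := hm
  rel_eq := by
    ext s
    constructor
    · rintro ⟨a, ha, has⟩
      exact ⟨a, ha, funext has⟩
    · rintro ⟨a, ha, has⟩
      exact ⟨a, ha, fun x => congrFun has x⟩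

theorem exists_isNet_of_ternarity_le {D S : Type*} {R : Set (S → D)} {m : ℕ}
    (h : ternarity R ≤ m) :
    ∃ (k N : ℕ) (L : Fin N → Finset (S ⊕ Fin k)) (G : Fin N → Set (S ⊕ Fin k → D)),
      IsNet m R L G := by
  unfold ternarity at h
  set X := {t : ℕ∞ | ∃ B : Bond D S, B.toRel = R ∧ B.IsSubternaric ∧ t = (B.numTernaries : ℕ∞)}
    with hX
  have hne : X.Nonempty := by
    by_contra hne
    rw [Set.not_nonempty_iff_eq_empty] at hne
    rw [hne, sInf_empty, top_le_iff] at h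
    exact ENat.natCast_ne_top m h
  obtain ⟨B, rfl, hB, ht⟩ := csInf_mem hne
  rw [ht, Nat.cast_le] at h
  exact ⟨_, _, _, _, B.isNet hB h⟩

/-- The normal form of relations of bounded ternarity: a net with few parameters in use, or a
nontrivial product. -/
theorem normalForm_of_ternarity_le {D S : Type*} [Fintype S] [DecidableEq S]
    {R : Set (S → D)} {m : ℕ} (h : ternarity R ≤ m) :
    (∃ (k N : ℕ) (L : Fin N → Finset (S ⊕ Fin k)) (G : Fin N → Set (S ⊕ Fin k → D)),
      IsNet m R L G ∧ Fintype.card S + 2 * (activeParams L).card ≤ 3 * m) ∨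
    ∃ (I : Finset S) (P Q : Set (S → D)), I.Nonempty ∧ I.card ≤ 2 ∧ SupportedOn P I ∧
      SupportedOn Q Iᶜ ∧ R = P ∩ Q := by
  obtain ⟨k, N, L, G, hnet⟩ := exists_isNet_of_ternarity_le h
  obtain ⟨L', G', hnet', hr⟩ := hnet.exists_reduced
  by_cases hfree : ∀ s i, Sum.inl s ∈ L' i → (L' i).card = 3
  · exact Or.inl ⟨k, N, L', G', hnet', hnet'.card_add_two_mul_le hr hfree⟩
  · push Not at hfree
    obtain ⟨s, i, hs, hi⟩ := hfree
    obtain ⟨I, P, Q, hsI, hI⟩ := hnet'.eq_inter hr hs hi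
    exact Or.inr ⟨I, P, Q, ⟨s, hsI⟩, hI⟩

/-- The diagonal is not a nontrivial product. -/
theorem diagonal_ne_inter {D S : Type*} [Nontrivial D] [Fintype S] [DecidableEq S]
    {I : Finset S} (hI : I.Nonempty) (hI' : I ≠ Finset.univ) {P Q : Set (S → D)}
    (hP : SupportedOn P I) (hQ : SupportedOn Q Iᶜ) :
    {r : S → D | ∀ x y, r x = r y} ≠ P ∩ Q := by
  intro heq
  obtain ⟨u, v, huv⟩ := exists_pair_ne D
  have hu : (fun _ : S => u) ∈ P ∩ Q := heq ▸ fun _ _ => rfl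
  have hv : (fun _ : S => v) ∈ P ∩ Q := heq ▸ fun _ _ => rfl
  have hmix : (fun x => if x ∈ I then u else v) ∈ P ∩ Q := by
    refine ⟨hP (fun x hx => ?_) hu.1, hQ (fun x hx => ?_) hv.2⟩
    · simp [hx]
    · simp [Finset.mem_compl.1 hx]
  rw [← heq] at hmix
  obtain ⟨x, hx⟩ := hI
  obtain ⟨y, hy⟩ : ∃ y, y ∉ I := by
    by_contra! hall
    exact hI' (Finset.eq_univ_iff_forall.2 hall)
  have := hmix x y
  simp only [hx, hy, if_true, if_false] at this
  exact huv this

/-! ### Encoding and counting -/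

/-- The relation represented by a family of relations, one for every set of `r` attributes. -/
def relOfFamily {D S T : Type*} {r : ℕ}
    (c : ∀ K : {K : Finset (S ⊕ T) // K.card = r}, Set (K.1 → D)) : Set (S → D) :=
  projJoin fun K => {a | (fun p : K.1 => a p.1) ∈ c K}

/-- Projections of joins of factors of arity at most `r` come from families of `r`-ary
relations. -/
theorem projJoin_mem_range_relOfFamily {D S T ι : Type*} [Fintype S] [Fintype T]
    [DecidableEq S] [DecidableEq T] {r : ℕ} (hr : r ≤ Fintype.card (S ⊕ T))
    {L : ι → Finset (S ⊕ T)} {G : ι → Set (S ⊕ T → D)} (hG : ∀ i, SupportedOn (G i) (L i))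
    (hL : ∀ i, (L i).card ≤ r) :
    projJoin G ∈ Set.range (relOfFamily (D := D) (S := S) (T := T) (r := r)) := by
  -- The relation on `K` collects all constraints whose schemes lie inside `K`; every scheme lies
  -- inside some `K`.
  refine ⟨fun K => {b | ∃ a : S ⊕ T → D, (∀ p : K.1, a p.1 = b p) ∧ ∀ i, L i ⊆ K.1 → a ∈ G i}, ?_⟩
  ext s
  refine exists_congr fun a => and_congr_left fun _ => ⟨fun h i => ?_, fun h K => ?_⟩
  · obtain ⟨K, hK, hKr⟩ := Finset.exists_superset_card_eq (hL i) hr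
    obtain ⟨b, hb, hbG⟩ := h ⟨K, hKr⟩
    exact hG i (fun x hx => hb ⟨x, hK hx⟩) (hbG i hK)
  · exact ⟨a, fun _ => rfl, fun i _ => h i⟩

/-- Relabelling of the parameters. -/
theorem projJoin_comap {D S T T' ι : Type*} [Nonempty S] {L : ι → Finset (S ⊕ T)}
    {G : ι → Set (S ⊕ T → D)} (hG : ∀ i, SupportedOn (G i) (L i)) {U : Set (S ⊕ T)}
    (hLU : ∀ i, ∀ x ∈ L i, x ∈ U) (hSU : ∀ s, Sum.inl s ∈ U) {φ : S ⊕ T → S ⊕ T'}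
    (hφ : Set.InjOn φ U) (hφS : ∀ s, φ (Sum.inl s) = Sum.inl s) :
    projJoin (fun i => {a : S ⊕ T' → D | a ∘ φ ∈ G i}) = projJoin G := by
  ext s
  constructor
  · rintro ⟨a, ha, has⟩
    exact ⟨a ∘ φ, ha, fun x => by simp [hφS, has]⟩
  · rintro ⟨a, ha, has⟩
    have key : ∀ x ∈ U, Function.invFunOn φ U (φ x) = x :=
      fun x hx => hφ.leftInvOn_invFunOn hx
    refine ⟨a ∘ Function.invFunOn φ U, fun i => hG i (fun x hx => ?_) (ha i), fun x => ?_⟩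
    · simp [key x (hLU i x hx)]
    · have := key _ (hSU x)
      rw [hφS] at this
      simp [this, has]

/-- Arity 3 is at most n - 1 because n ≥ 4, and in a product the complement of the nonempty `I` has
at most n - 1 elements. The `+ 1` in `hp` accounts for rounding: n + 2q ≤ 3m ≤ n + 2p + 1 forces q ≤
p. -/
theorem mem_range_relOfFamily_of_ternarity_le {D S : Type*} [Fintype S] [DecidableEq S]
    (hS : 4 ≤ Fintype.card S) {R : Set (S → D)} {m p r : ℕ}
    (hr : r + 1 = Fintype.card S) (hp : 3 * m ≤ Fintype.card S + 2 * p + 1) (h : ternarity R ≤ m) :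
    R ∈ Set.range (relOfFamily (D := D) (S := S) (T := Fin p) (r := r)) := by
  have hne : Nonempty S := Fintype.card_pos_iff.1 (by omega)
  have hcard : r ≤ Fintype.card (S ⊕ Fin p) := by simp; omega
  rcases normalForm_of_ternarity_le h with ⟨k, N, L, G, hnet, hle⟩ | ⟨I, P, Q, hI, hI2, hP, hQ, rfl⟩
  · have hc : Fintype.card (activeParams L) ≤ Fintype.card (Fin p) := by
      simp only [Fintype.card_coe, Fintype.card_fin]
      omega
    obtain ⟨f⟩ := Function.Embedding.nonempty_of_card_le hc
    -- Unused parameters get a junk value; injectivity is needed only on `U`.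
    let φ : S ⊕ Fin k → S ⊕ Fin p := Sum.elim Sum.inl fun t =>
      if ht : t ∈ activeParams L then Sum.inr (f ⟨t, ht⟩) else Sum.inl (Classical.arbitrary S)
    let U : Set (S ⊕ Fin k) := {x | ∀ t, x = Sum.inr t → t ∈ activeParams L}
    have hφ : Set.InjOn φ U := by
      rintro (x | t) hx (y | u) hy hxy
      · simpa [φ] using hxy
      · simp [φ, hy u rfl] at hxy
      · simp [φ, hx t rfl] at hxy
      · simpa [φ, hx t rfl, hy u rfl] using hxy
    rw [← hnet.rel_eq, ← projJoin_comap hnet.supported (U := U) ?_ ?_ hφ fun s => rfl]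
    · refine projJoin_mem_range_relOfFamily (L := fun i => (L i).image φ) hcard
        (fun i a b hab ha => ?_) fun i => ?_
      · exact hnet.supported i (fun x hx => hab _ (Finset.mem_image_of_mem φ hx)) ha
      · have h1 := hnet.card_le i
        have h2 := Finset.card_image_le (s := L i) (f := φ)
        omega
    · rintro i x hx t rfl
      simpa [activeParams] using ⟨i, hx⟩
    · rintro s t ht
      cases ht
  · let J : Bool → Finset S := fun b => bif b then I else Iᶜ
    let H : Bool → Set (S → D) := fun b => bif b then P else Q
    have hH : ∀ b, SupportedOn (H b) (J b) := by
      rintro (_ | _)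
      · exact hQ
      · exact hP
    -- The `p` superfluous parameters need some value in `D`.
    by_cases hD : Nonempty D
    · have heq : P ∩ Q = projJoin (T := Fin p)
          fun b => {a : S ⊕ Fin p → D | a ∘ Sum.inl ∈ H b} := by
        ext s
        constructor
        · rintro ⟨h1, h2⟩
          refine ⟨Sum.elim s fun _ => Classical.arbitrary D, ?_, fun _ => rfl⟩
          rintro (_ | _)
          · exact h2
          · exact h1
        · rintro ⟨a, ha, has⟩
          obtain rfl : a ∘ Sum.inl = s := funext has
          exact ⟨ha true, ha false⟩
      rw [heq]
      refine projJoin_mem_range_relOfFamily (L := fun b => (J b).map Function.Embedding.inl)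
        hcard (fun b a a' haa ha => ?_) fun b => ?_
      · exact hH b (fun x hx => haa _ (Finset.mem_map_of_mem _ hx)) ha
      · have h1 := I.card_compl
        have h2 := hI.card_pos
        rw [Finset.card_map]
        rcases b with _ | _
        · change Iᶜ.card ≤ _
          omega
        · change I.card ≤ _
          omega
    · have : IsEmpty (S → D) := ⟨fun s => hD ⟨s (Classical.arbitrary S)⟩⟩
      exact ⟨fun _ => ∅, Subsingleton.elim _ _⟩

theorem ncard_ternarity_le {D : Type*} [Finite D] {n m p : ℕ} (hn : 4 ≤ n)
    (hp : 3 * m ≤ n + 2 * p + 1) :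
    {R : Set (Fin n → D) | ternarity R ≤ (m : ℕ∞)}.ncard ≤
      2 ^ (Nat.choose (n + p) (n - 1) * Nat.card D ^ (n - 1)) := by
  have hsub : {R : Set (Fin n → D) | ternarity R ≤ (m : ℕ∞)} ⊆
      Set.range (relOfFamily (D := D) (S := Fin n) (T := Fin p) (r := n - 1)) := by
    intro R hR
    exact mem_range_relOfFamily_of_ternarity_le (by simpa) (by simp; omega) (by simpa) hR
  refine (Set.ncard_le_ncard hsub (Set.toFinite _)).trans ?_
  rw [← Set.image_univ]
  refine (Set.ncard_image_le (Set.toFinite _)).trans ?_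
  rw [Set.ncard_univ, Nat.card_pi]
  have : ∀ K : {K : Finset (Fin n ⊕ Fin p) // K.card = n - 1},
      Nat.card (Set (K.1 → D)) = 2 ^ (Nat.card D ^ (n - 1)) := by
    intro K
    have := Fintype.ofFinite D
    classical
    rw [Nat.card_eq_fintype_card, Fintype.card_set, Fintype.card_fun, Fintype.card_coe, K.2,
      Nat.card_eq_fintype_card]
  rw [Finset.prod_congr rfl fun K _ => this K, Finset.prod_const, Finset.card_univ,
    Fintype.card_finset_len, ← pow_mul, mul_comm]
  simp

theorem natCard_set_tuples (D : Type*) [Finite D] (n : ℕ) :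
    Nat.card (Set (Fin n → D)) = 2 ^ (Nat.card D ^ n) := by
  have := Fintype.ofFinite D
  classical
  rw [Nat.card_eq_fintype_card, Fintype.card_set, Fintype.card_fun, Fintype.card_fin,
    Nat.card_eq_fintype_card]

theorem ternarityShare_lt_one_iff {D : Type*} [Finite D] {n m : ℕ} :
    ternarityShare D n m < 1 ↔ ∃ R : Set (Fin n → D), (m : ℕ∞) < ternarity R := by
  have hpos : 0 < Nat.card (Set (Fin n → D)) := Nat.card_pos
  rw [ternarityShare, div_lt_one (by exact_mod_cast hpos), Nat.cast_lt, ← Set.ncard_univ,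
    ← not_iff_not, not_lt]
  push Not
  constructor
  · intro h R
    have := Set.eq_of_subset_of_ncard_le (Set.subset_univ _) h (Set.toFinite _)
    exact (Set.ext_iff.1 this R).2 trivial
  · intro h
    exact Set.ncard_le_ncard (fun R _ => h R) (Set.toFinite _)

theorem ternarityShare_le {D : Type*} [Finite D] {n m p : ℕ} (hn : 4 ≤ n)
    (hp : 3 * m ≤ n + 2 * p + 1) :
    ternarityShare D n m ≤
      (2 : ℝ) ^ (Nat.choose (n + p) (n - 1) * Nat.card D ^ (n - 1)) / 2 ^ (Nat.card D ^ n) := by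
  rw [ternarityShare, natCard_set_tuples]
  push_cast
  gcongr
  exact_mod_cast ncard_ternarity_le hn hp

theorem ternarityShare_lt_one_of_choose_lt {D : Type*} [Finite D] {n m : ℕ} (hn : 4 ≤ n)
    (hD : 2 ≤ Nat.card D) (h : Nat.choose ((3 * m + n) / 2) (n - 1) < Nat.card D) :
    ternarityShare D n m < 1 := by
  -- For 3m < n there is no p with n + p = ⌊(3m+n)/2⌋. The incidence bound then excludes the first
  -- normal form, and the diagonal is not of the second.
  by_cases hm : n ≤ 3 * m
  · obtain ⟨p, hp⟩ : ∃ p, (3 * m + n) / 2 = n + p := Nat.exists_eq_add_of_le (by omega)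
    refine (ternarityShare_le (p := p) hn (by omega)).trans_lt ?_
    rw [div_lt_one (by positivity)]
    refine pow_lt_pow_right₀ one_lt_two ?_
    rw [← hp]
    calc _ < Nat.card D * Nat.card D ^ (n - 1) := by gcongr
      _ = Nat.card D ^ n := by rw [← pow_succ', Nat.sub_add_cancel (by omega)]
  · have : Nontrivial D := Finite.one_lt_card_iff_nontrivial.1 (by omega)
    rw [ternarityShare_lt_one_iff]
    refine ⟨{r | ∀ x y, r x = r y}, not_le.1 fun hle => ?_⟩
    rcases normalForm_of_ternarity_le hle with ⟨_, _, _, _, -, hc⟩ | ⟨I, P, Q, hI, hI2, hP, hQ, heq⟩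
    · rw [Fintype.card_fin] at hc
      omega
    · refine diagonal_ne_inter hI ?_ hP hQ heq
      rintro rfl
      rw [Finset.card_univ, Fintype.card_fin] at hI2
      omega

theorem exists_forall_ternarityShare_lt (n : ℕ) (hn : 4 ≤ n) (m : ℕ) {ε : ℝ} (hε : 0 < ε) :
    ∃ N : ℕ, ∀ (D : Type*) [Finite D], N ≤ Nat.card D → ternarityShare D n m < ε := by
  obtain ⟨k, hk⟩ := exists_pow_lt_of_lt_one hε (by norm_num : (1 / 2 : ℝ) < 1)
  -- The crude choice p = 3m suffices; once d ≥ C + k, the share is at most 2^(-k).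
  set C := Nat.choose (n + 3 * m) (n - 1) with hC
  refine ⟨C + k + 1, fun D _ hN => ?_⟩
  refine (ternarityShare_le (p := 3 * m) hn (by omega)).trans_lt (lt_of_le_of_lt ?_ hk)
  rw [← hC]
  set d := Nat.card D
  have h1 : C * d ^ (n - 1) + k ≤ d ^ n := by
    have h2 : 1 ≤ d ^ (n - 1) := Nat.one_le_pow _ _ (by omega)
    calc C * d ^ (n - 1) + k ≤ C * d ^ (n - 1) + k * d ^ (n - 1) := by
          gcongr; exact Nat.le_mul_of_pos_right _ h2
      _ = (C + k) * d ^ (n - 1) := by ring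
      _ ≤ d * d ^ (n - 1) := by gcongr; omega
      _ = d ^ n := by rw [← pow_succ', Nat.sub_add_cancel (by omega)]
  rw [div_le_iff₀ (by positivity), one_div, inv_pow, inv_mul_eq_div, le_div_iff₀ (by positivity),
    ← pow_add]
  exact pow_le_pow_right₀ one_le_two h1

theorem mainTheorem6 (n : ℕ) (hn : 4 ≤ n) (m : ℕ) :
    (∀ (D : Type*) [Finite D], 2 ≤ Nat.card D →
      Nat.choose ((3 * m + n) / 2) (n - 1) < Nat.card D → ternarityShare D n m < 1) ∧
    (∀ ε : ℝ, 0 < ε → ∃ N : ℕ, ∀ (D : Type*) [Finite D], N ≤ Nat.card D →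
      ternarityShare D n m < ε) ∧
    (∃ (d : ℕ) (R : Set (Fin n → Fin d)), (m : ℕ∞) < ternarity R) := by
  refine ⟨fun D _ hD h => ternarityShare_lt_one_of_choose_lt hn hD h,
    fun ε hε => exists_forall_ternarityShare_lt n hn m hε, ?_⟩
  obtain ⟨N, hN⟩ := exists_forall_ternarityShare_lt n hn m one_pos
  exact ⟨N, ternarityShare_lt_one_iff.1 (hN (Fin N) (by simp))⟩
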